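/- Let $\phi:\mathbb{C}\to\mathbb{C}$ be an entire function that is not a polynomial, and let $D\subset\mathbb{C}$ be a simply-connected domain (open, non-empty, connected and simply connected; $D=\mathbb{C}$ is allowed). Then one-hidden-layer neural networks with activation function $\phi$ approximate every holomorphic function on $D$ uniformly on compact subsets of $D$. That is, for every function $g$ holomorphic on $D$, every compact set $K\subset D$ and every $\varepsilon>0$, there exist an integer $N\ge 1$ and complex numbers $a_j,b_j,c_j$ ($j=1,\dots,N$) such that $$\sup_{z\in K}\Bigl|\,g(z)-\sum_{j=1}^{N}a_j\,\phi(b_j z+c_j)\Bigr|<\varepsilon .$$ -/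

import Mathlib

/-- The one-hidden-layer network `z ↦ ∑ j, a j * φ (b j * z + c j)` with `N` hidden units,
activation function `φ` and complex parameters `a`, `b`, `c`. -/
def shallowNetwork (φ : ℂ → ℂ) {N : ℕ} (a b c : Fin N → ℂ) (z : ℂ) : ℂ :=
  ∑ j : Fin N, a j * φ (b j * z + c j)

/-!
Fix a compact set `K ⊆ D` and work in the Banach space `C(K, ℂ)`.

*From networks to polynomials.* Let `V` be the closed span of the hidden units `φ (b z + c)`.
Expanding in powers of `b`, a functional that kills `V` kills `φ⁽ⁿ⁾(c) z ^ n` for all `n` and `c`.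
As `φ` is not a polynomial, no derivative of `φ` vanishes identically, so `V` contains all monomials
(`coordFun_pow_mem_of_hiddenUnit_mem`), hence the closure `P(K)` of the polynomials.

*From polynomials to holomorphic functions.* It remains to prove Runge's theorem: the restriction
to `K` of a function holomorphic on `D` lies in `P(K)` (`mem_polyClosure_of_differentiableOn`). Let
`W` be the set of all `w` for which `z ↦ 1 / (w - z)` lies in `P(K)`. By pole pushing, `W` is open,
relatively closed in `Kᶜ`, and contains a neighbourhood of infinity. So `Wᶜ` is compact and
`Wᶜ \ K` is open, with frontier in `K`. Simple connectedness of `D` enters only through the fact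
that a bounded set with frontier in `D` lies in `D` (`IsSimplyConnected.subset_of_frontier_subset`),
which is proved with continuous logarithms and Tietze's extension theorem; it gives `Wᶜ ⊆ D`.
Now cut `g` off outside a neighbourhood of `Wᶜ`. The Cauchy–Pompeiu formula
(`integral_dbar_div_sub`) represents `g` on `K` as an integral of multiples of Cauchy kernels with
poles in `W`, and such an integral lies in the closed subspace `P(K)`.
-/

/-! ### Monomials in the closed span of the hidden units -/

theorem Submodule.mem_of_forall_dual_eq_zero {E : Type*} [NormedAddCommGroup E] [NormedSpace ℂ E]
    {N : Submodule ℂ E} (hN : IsClosed (N : Set E)) {x : E}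
    (h : ∀ ℓ : StrongDual ℂ E, (∀ y ∈ N, ℓ y = 0) → ℓ x = 0) : x ∈ N := by
  by_contra hx
  have : IsClosed (N : Set E) := hN
  have hx' : (N.mkQL x : E ⧸ N) ≠ 0 := by simpa using hx
  obtain ⟨ℓ, hℓ⟩ := SeparatingDual.exists_ne_zero (R := ℂ) hx'
  refine hℓ (h (ℓ.comp N.mkQL) fun y hy => ?_)
  have : (N.mkQL y : E ⧸ N) = 0 := by simpa using hy
  simp [this]

/-- An entire function one of whose derivatives vanishes identically is a polynomial. -/
theorem exists_polynomial_of_iteratedDeriv_eq_zero {φ : ℂ → ℂ} (hφ : Differentiable ℂ φ) {n : ℕ}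
    (h : ∀ c, iteratedDeriv n φ c = 0) : ∃ p : Polynomial ℂ, ∀ z, φ z = p.eval z := by
  refine ⟨∑ k ∈ Finset.range n,
    Polynomial.C ((k.factorial : ℂ)⁻¹ * iteratedDeriv k φ 0) * Polynomial.X ^ k, fun z => ?_⟩
  have hs := Complex.hasSum_taylorSeries_of_entire hφ 0 z
  have h0 : ∀ k ∉ Finset.range n,
      (k.factorial : ℂ)⁻¹ • (z - 0) ^ k • iteratedDeriv k φ 0 = 0 := by
    intro k hk
    obtain ⟨m, rfl⟩ := Nat.exists_eq_add_of_le (not_lt.1 (by simpa using hk))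
    have h1 : iteratedDeriv n φ = fun _ => (0 : ℂ) := funext h
    have : iteratedDeriv (n + m) φ 0 = 0 := by
      rw [add_comm, iteratedDeriv_eq_iterate, Function.iterate_add_apply,
        ← iteratedDeriv_eq_iterate, ← iteratedDeriv_eq_iterate, h1]
      simp
    simp [this]
  rw [hs.unique (hasSum_sum_of_ne_finset_zero h0), Polynomial.eval_finsetSum]
  refine Finset.sum_congr rfl fun k _ => ?_
  simp only [sub_zero, smul_eq_mul, Polynomial.eval_mul, Polynomial.eval_C, Polynomial.eval_pow,
    Polynomial.eval_X]
  ring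

/-- The coordinate function `z ↦ z` on `K`, as an element of the Banach algebra `C(K, ℂ)`. -/
def coordFun (K : Set ℂ) : C(K, ℂ) := ⟨Subtype.val, continuous_subtype_val⟩

@[simp] theorem coordFun_apply (K : Set ℂ) (z : K) : coordFun K z = z := rfl

/-- The hidden unit `z ↦ φ (b * z + c)`, restricted to `K`. -/
def hiddenUnit (φ : ℂ → ℂ) (hφ : Continuous φ) (K : Set ℂ) (b c : ℂ) : C(K, ℂ) :=
  ⟨fun z => φ (b * z + c), by fun_prop⟩

/-- The Taylor series of `φ` at `c`, read as a power series in `b` that converges in `C(K, ℂ)`. -/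
theorem hasSum_hiddenUnit {φ : ℂ → ℂ} (hφ : Differentiable ℂ φ) (K : Set ℂ) [CompactSpace K]
    (b c : ℂ) :
    HasSum (fun n : ℕ => b ^ n • (((n.factorial : ℂ)⁻¹ * iteratedDeriv n φ c) • coordFun K ^ n))
      (hiddenUnit φ hφ.continuous K b c) := by
  have hsum : Summable
      (fun n : ℕ => b ^ n • (((n.factorial : ℂ)⁻¹ * iteratedDeriv n φ c) • coordFun K ^ n)) := by
    have h := (Complex.hasSum_taylorSeries_of_entire hφ c
      (c + ‖b‖ * ‖coordFun K‖)).summable.norm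
    refine Summable.of_norm_bounded h fun n => ?_
    simp only [norm_smul, norm_mul, norm_pow, add_sub_cancel_left, Complex.norm_real, norm_norm,
      mul_pow]
    calc _ ≤ ‖b‖ ^ n * (‖(n.factorial : ℂ)⁻¹‖ * ‖iteratedDeriv n φ c‖ * ‖coordFun K‖ ^ n) := by
          gcongr
          refine (ContinuousMap.norm_le _ (by positivity)).2 fun z => ?_
          rw [ContinuousMap.pow_apply, norm_pow]
          gcongr
          exact (coordFun K).norm_coe_le_norm z
      _ = _ := by ring
  convert hsum.hasSum using 1
  ext z
  have h1 := hsum.hasSum.map (ContinuousMap.evalCLM ℂ z : C(K, ℂ) →L[ℂ] ℂ)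
    (ContinuousMap.evalCLM ℂ z : C(K, ℂ) →L[ℂ] ℂ).continuous
  have h2 := Complex.hasSum_taylorSeries_of_entire hφ c (b * z + c)
  refine h2.unique ?_
  convert! h1 using 1
  ext n
  simp
  ring

/-- A closed subspace of `C(K, ℂ)` that contains all hidden units contains all monomials: a
functional `ℓ` that kills the units `φ (b z + c)` kills the power series
`∑ b ^ n * φ⁽ⁿ⁾(c) / n! * ℓ (z ^ n)` for every `b`, hence each of its coefficients, and `c` can be
chosen with `φ⁽ⁿ⁾(c) ≠ 0`. -/
theorem coordFun_pow_mem_of_hiddenUnit_mem {φ : ℂ → ℂ} (hφ : Differentiable ℂ φ)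
    (hpoly : ¬ ∃ p : Polynomial ℂ, ∀ z : ℂ, φ z = p.eval z) (K : Set ℂ) [CompactSpace K]
    {N : Submodule ℂ C(K, ℂ)} (hN : IsClosed (N : Set C(K, ℂ)))
    (hu : ∀ b c, hiddenUnit φ hφ.continuous K b c ∈ N) (n : ℕ) : coordFun K ^ n ∈ N := by
  obtain ⟨c, hc⟩ : ∃ c, iteratedDeriv n φ c ≠ 0 := by
    by_contra! h
    exact hpoly (exists_polynomial_of_iteratedDeriv_eq_zero hφ h)
  refine Submodule.mem_of_forall_dual_eq_zero hN fun ℓ hℓ => ?_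
  have hps : HasFPowerSeriesAt (0 : ℂ → ℂ) (FormalMultilinearSeries.ofScalars ℂ (fun k : ℕ =>
      ((k.factorial : ℂ)⁻¹ * iteratedDeriv k φ c) * ℓ (coordFun K ^ k))) 0 := by
    rw [hasFPowerSeriesAt_iff]
    refine Filter.Eventually.of_forall fun b => ?_
    have h := (hasSum_hiddenUnit hφ K b c).map ℓ ℓ.continuous
    rw [hℓ _ (hu b c)] at h
    convert! h using 1
    ext k
    simp [FormalMultilinearSeries.coeff_ofScalars]
  have h0 := congrArg (fun p : FormalMultilinearSeries ℂ ℂ ℂ => p.coeff n) hps.eq_zero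
  have h1 : FormalMultilinearSeries.coeff (0 : FormalMultilinearSeries ℂ ℂ ℂ) n = 0 := rfl
  simpa [FormalMultilinearSeries.coeff_ofScalars, hc, Nat.factorial_ne_zero, h1] using h0

/-! ### Simply connected open sets have no holes -/

open Complex Set in
/-- The function `z - a` has no continuous logarithm near infinity: along a large circle around `a`
the logarithm would change by `2πi`. -/
theorem not_exists_continuous_exp_eq_sub_outside_ball {a : ℂ} {R : ℝ} {G : ℂ → ℂ}
    (hG : Continuous G) (h : ∀ z, R ≤ ‖z - a‖ → exp (G z) = z - a) : False := by
  set r : ℝ := max R 1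
  have hr : 0 < r := lt_max_of_lt_right one_pos
  set k : ℝ → ℂ := fun θ => (G (a + r * exp (θ * I)) - Real.log r - θ * I) / (2 * Real.pi * I)
  have hk : Continuous k := by fun_prop
  -- The difference between `G` and the polar logarithm is an integer multiple of `2πi`.
  have hint : ∀ θ, k θ ∈ range ((↑) : ℤ → ℂ) := by
    intro θ
    have hn : ‖a + r * exp (θ * I) - a‖ = r := by simp [norm_exp_ofReal_mul_I, abs_of_pos hr]
    have h1 := h (a + r * exp (θ * I)) (by rw [hn]; exact le_max_left _ _)
    have h2 : exp (G (a + r * exp (θ * I)) - Real.log r - θ * I) = 1 := by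
      rw [exp_sub, exp_sub, h1, ← ofReal_exp, Real.exp_log hr, add_sub_cancel_left]
      have := exp_ne_zero (θ * I)
      have : (r : ℂ) ≠ 0 := by exact_mod_cast hr.ne'
      field_simp
    obtain ⟨n, hn⟩ := exp_eq_one_iff.1 h2
    refine ⟨n, ?_⟩
    simp only [k, hn]
    have := two_pi_I_ne_zero
    field_simp
  have hconst : k (2 * Real.pi) = k 0 := by
    choose m hm using hint
    have hmc : Continuous m := by
      rw [Int.isClosedEmbedding_coe_real.isInducing.continuous_iff]
      have : ((↑) : ℤ → ℝ) ∘ m = fun θ => (k θ).re := by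
        ext θ; simp [← hm]
      rw [this]; fun_prop
    rw [← hm, ← hm, PreconnectedSpace.constant inferInstance hmc]
  have h2pi := two_pi_I_ne_zero
  simp only [k, ofReal_mul, ofReal_ofNat, exp_two_pi_mul_I, ofReal_zero, zero_mul, exp_zero] at hconst
  rw [div_left_inj' h2pi] at hconst
  apply h2pi
  linear_combination -hconst

open Complex Set in
/-- A bounded set whose frontier lies in a simply connected open set `D` is itself contained in `D`:
simply connected open sets have no holes. If `a ∈ U \ D`, then a logarithm of `z - a` on `D`,
extended from `frontier U` to the plane by Tietze's theorem, yields a nowhere vanishing continuous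
function on the plane that equals `z - a` outside `U`. That function has a continuous logarithm,
whereas `z - a` has none near infinity. -/
theorem IsSimplyConnected.subset_of_frontier_subset {D : Set ℂ} (hDo : IsOpen D)
    (hDs : IsSimplyConnected D) {U : Set ℂ} (hUb : Bornology.IsBounded U)
    (hfr : frontier U ⊆ D) : U ⊆ D := by
  classical
  intro a haU
  by_contra haD
  obtain ⟨L, hLc, hL⟩ := exists_continuousOn_eqOn_exp_comp hDs hDo (g := fun z => z - a)
    (by fun_prop) (by rintro ⟨z, hz, h⟩; exact haD (sub_eq_zero.1 h ▸ hz))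
  obtain ⟨L', hL'⟩ := ContinuousMap.exists_restrict_eq (Y := ℂ) (s := frontier U) isClosed_frontier
    ⟨(frontier U).domRestrict L, (hLc.mono hfr).domRestrict⟩
  have hLL : ∀ z ∈ frontier U, L' z = L z := fun z hz => congrArg (fun f => f ⟨z, hz⟩) hL'
  set F : ℂ → ℂ := fun z => if z ∈ U then exp (L' z) else z - a
  have hF : Continuous F := by
    refine Continuous.if (fun z hz => ?_) (by fun_prop) (by fun_prop)
    rw [hLL z hz]
    exact hL (hfr hz)
  have hF0 : ∀ z, F z ≠ 0 := by
    intro z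
    by_cases hz : z ∈ U
    · simp [F, hz]
    · simp only [F, hz, if_false]
      rintro h
      exact hz (sub_eq_zero.1 h ▸ haU)
  have huniv : IsSimplyConnected (univ : Set ℂ) :=
    have := (convex_univ : Convex ℝ (univ : Set ℂ)).contractibleSpace univ_nonempty
    SimplyConnectedSpace.ofContractible _
  obtain ⟨G, hGc, hG⟩ := exists_continuousOn_eqOn_exp_comp huniv isOpen_univ hF.continuousOn
    (by rintro ⟨z, -, h⟩; exact hF0 z h)
  obtain ⟨R, hR⟩ := hUb.subset_ball a
  refine not_exists_continuous_exp_eq_sub_outside_ball (a := a) (R := R)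
    (continuousOn_univ.1 hGc) fun z hz => ?_
  have hzU : z ∉ U := fun h => by
    have := hR h
    rw [mem_ball_iff_norm] at this
    linarith
  have := hG (mem_univ z)
  simpa [F, hzU] using this

/-! ### The Cauchy–Pompeiu formula -/

section CauchyPompeiu

open Complex Topology Filter MeasureTheory

/-- Twice the Wirtinger derivative `∂u/∂z̄`, that is `∂u/∂x + i ∂u/∂y`. -/
noncomputable def dbar (u : ℂ → ℂ) (w : ℂ) : ℂ := fderiv ℝ u w 1 + I * fderiv ℝ u w I

theorem dbar_eq_zero {u : ℂ → ℂ} {w : ℂ} (h : DifferentiableAt ℂ u w) : dbar u w = 0 := by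
  have h1 : fderiv ℝ u w = (fderiv ℂ u w).restrictScalars ℝ :=
    (h.hasFDerivAt.restrictScalars ℝ).fderiv
  have h2 : fderiv ℂ u w I = I * fderiv ℂ u w 1 := by
    rw [← smul_eq_mul, ← map_smul, smul_eq_mul, mul_one]
  rw [dbar, h1, ContinuousLinearMap.coe_restrictScalars', h2, ← mul_assoc, I_mul_I]
  ring

theorem Filter.EventuallyEq.dbar_eq {u v : ℂ → ℂ} {w : ℂ} (h : u =ᶠ[𝓝 w] v) :
    dbar u w = dbar v w := by
  rw [dbar, dbar, h.fderiv_eq]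

theorem dbar_mul {u v : ℂ → ℂ} {w : ℂ} (hu : DifferentiableAt ℝ u w)
    (hv : DifferentiableAt ℝ v w) : dbar (fun x => u x * v x) w = dbar u w * v w + u w * dbar v w := by
  simp only [dbar]
  rw [fderiv_fun_mul hu hv]
  simp only [add_apply, smul_apply, smul_eq_mul]
  ring

theorem dbar_sub_const_mul {u v : ℂ → ℂ} {w : ℂ} (a : ℂ) (hu : DifferentiableAt ℝ u w)
    (hv : DifferentiableAt ℝ v w) : dbar (fun x => u x - a * v x) w = dbar u w - a * dbar v w := by
  simp only [dbar]
  rw [fderiv_fun_sub hu (hv.const_mul a), fderiv_const_mul hv]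
  simp only [sub_apply, smul_apply, smul_eq_mul]
  ring

theorem ContDiff.continuous_dbar {u : ℂ → ℂ} (hu : ContDiff ℝ 1 u) : Continuous (dbar u) := by
  have := hu.continuous_fderiv one_ne_zero
  unfold dbar
  fun_prop

theorem support_dbar_subset (u : ℂ → ℂ) : Function.support (dbar u) ⊆ tsupport u := by
  refine Function.support_subset_iff'.2 fun w hw => ?_
  rw [(notMem_tsupport_iff_eventuallyEq.1 hw).dbar_eq]
  exact dbar_eq_zero (differentiableAt_const 0)

theorem integral_dbar_eq_zero {f : ℂ → ℂ} (hf : ContDiff ℝ 1 f) (hc : HasCompactSupport f) :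
    ∫ w, dbar f w = 0 := by
  have hi : ∀ v : ℂ, Integrable (fun w => fderiv ℝ f w v) := fun v =>
    ((hf.continuous_fderiv one_ne_zero).clm_apply continuous_const).integrable_of_hasCompactSupport
      (hc.fderiv_apply ℝ v)
  have h0 : ∀ v : ℂ, ∫ w, fderiv ℝ f w v = 0 := by
    intro v
    have := integral_mul_fderiv_eq_neg_fderiv_mul_of_integrable (𝕜 := ℂ)
      (μ := (volume : Measure ℂ)) (f := fun _ => (1 : ℂ)) (g := f) (v := v) (by simp)
      (by simpa using hi v) (by simpa using hf.continuous.integrable_of_hasCompactSupport hc)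
      (fun _ _ => differentiableAt_const _) (fun x _ => hf.differentiable one_ne_zero x)
    simpa using this
  simp only [dbar]
  rw [integral_add (hi 1) ((hi I).const_mul I), integral_const_mul, h0, h0]
  simp

theorem continuous_dbar_div_sub {u : ℂ → ℂ} (hu : ContDiff ℝ 1 u) {z : ℂ}
    (hz : ∀ᶠ w in 𝓝 z, DifferentiableAt ℂ u w) : Continuous fun w => dbar u w / (w - z) := by
  refine continuous_iff_continuousAt.2 fun w => ?_
  rcases eq_or_ne w z with rfl | hw
  · refine (continuousAt_const (y := (0 : ℂ))).congr ?_
    filter_upwards [hz] with x hx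
    simp [dbar_eq_zero hx]
  · exact hu.continuous_dbar.continuousAt.div (by fun_prop) (sub_ne_zero.2 hw)

theorem integrable_dbar_div_sub {u : ℂ → ℂ} (hu : ContDiff ℝ 1 u) (hc : HasCompactSupport u) {z : ℂ}
    (hz : ∀ᶠ w in 𝓝 z, DifferentiableAt ℂ u w) : Integrable fun w => dbar u w / (w - z) := by
  refine (continuous_dbar_div_sub hu hz).integrable_of_hasCompactSupport
    (HasCompactSupport.intro hc fun w hw => ?_)
  rw [Function.support_subset_iff'.1 (support_dbar_subset u) w hw, zero_div]

/-- The case `u z = 0` of the Cauchy–Pompeiu formula: `u w / (w - z)` is then again of class `C^1`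
with compact support, and `dbar` of such a function has integral zero. -/
theorem integral_dbar_div_sub_of_eq_zero {u : ℂ → ℂ} (hu : ContDiff ℝ 1 u)
    (hc : HasCompactSupport u) {z : ℂ} (hz : ∀ᶠ w in 𝓝 z, DifferentiableAt ℂ u w)
    (h0 : u z = 0) : ∫ w, dbar u w / (w - z) = 0 := by
  have hne : ∀ w, w ≠ z → dslope u z =ᶠ[𝓝 w] fun x => (x - z)⁻¹ * u x := by
    intro w hw
    filter_upwards [isOpen_ne.mem_nhds hw] with x hx
    simp [dslope_of_ne u hx, slope_def_field, h0, div_eq_inv_mul]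
  obtain ⟨S, hSz, hS⟩ : ∃ S ∈ 𝓝 z, DifferentiableOn ℂ (dslope u z) S := by
    obtain ⟨S, hS, hSd⟩ := eventually_iff_exists_mem.1 hz
    exact ⟨S, hS, (differentiableOn_dslope hS).2 fun x hx =>
      (hSd x hx).differentiableWithinAt⟩
  have hf : ContDiff ℝ 1 (dslope u z) := by
    refine contDiff_iff_contDiffAt.2 fun w => ?_
    rcases eq_or_ne w z with rfl | hw
    · exact ((hS.analyticAt hSz).contDiffAt).restrict_scalars ℝ
    · refine ContDiffAt.congr_of_eventuallyEq ?_ (hne w hw)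
      exact ((contDiffAt_id.sub contDiffAt_const).inv (sub_ne_zero.2 hw)).mul hu.contDiffAt
  have hfc : HasCompactSupport (dslope u z) := by
    refine HasCompactSupport.intro (K := insert z (tsupport u)) (hc.isCompact.insert z) ?_
    intro w hw
    rw [Set.mem_insert_iff, not_or] at hw
    rw [(hne w hw.1).eq_of_nhds, image_eq_zero_of_notMem_tsupport hw.2, mul_zero]
  rw [← integral_dbar_eq_zero hf hfc]
  congr 1
  ext w
  rcases eq_or_ne w z with rfl | hw
  · rw [dbar_eq_zero (hS.differentiableAt hSz)]
    simp
  · have hi : DifferentiableAt ℂ (fun x => (x - z)⁻¹) w := by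
      have := sub_ne_zero.2 hw
      fun_prop (disch := assumption)
    rw [(hne w hw).dbar_eq, dbar_mul (hi.restrictScalars ℝ) (hu.differentiable one_ne_zero w),
      dbar_eq_zero hi]
    field_simp
    simp

/-- A smooth radial function, equal to `1` on the unit disc and with compact support. -/
noncomputable def radialBump (w : ℂ) : ℂ := (Real.smoothTransition (2 - normSq w) : ℝ)

theorem contDiff_radialBump : ContDiff ℝ 1 radialBump := by
  have h : ContDiff ℝ 1 fun w : ℂ => w.re * w.re + w.im * w.im := by
    have h1 : ContDiff ℝ 1 re := reCLM.contDiff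
    have h2 : ContDiff ℝ 1 im := imCLM.contDiff
    fun_prop
  exact ofRealCLM.contDiff.comp (Real.smoothTransition.contDiff.comp (contDiff_const.sub h))

theorem radialBump_of_norm_le_one {w : ℂ} (h : ‖w‖ ≤ 1) : radialBump w = 1 := by
  have : normSq w ≤ 1 := by rw [normSq_eq_norm_sq]; nlinarith [norm_nonneg w]
  rw [radialBump, Real.smoothTransition.one_of_one_le (by linarith), ofReal_one]

theorem radialBump_of_two_le_norm {w : ℂ} (h : 2 ≤ ‖w‖) : radialBump w = 0 := by
  have : 2 ≤ normSq w := by rw [normSq_eq_norm_sq]; nlinarith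
  rw [radialBump, Real.smoothTransition.zero_of_nonpos (by linarith), ofReal_zero]

theorem hasCompactSupport_radialBump : HasCompactSupport radialBump := by
  refine HasCompactSupport.intro (isCompact_closedBall 0 2) fun w hw => ?_
  exact radialBump_of_two_le_norm (le_of_lt (by simpa using hw))

theorem eventually_radialBump_eq_one : radialBump =ᶠ[𝓝 0] fun _ => 1 := by
  filter_upwards [Metric.closedBall_mem_nhds (0 : ℂ) one_pos] with w hw
  exact radialBump_of_norm_le_one (by simpa using hw)

theorem dbar_radialBump (w : ℂ) :
    dbar radialBump w = -(2 * deriv Real.smoothTransition (2 - normSq w) : ℝ) * w := by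
  have hT : HasDerivAt Real.smoothTransition _ (2 - normSq w) :=
    ((Real.smoothTransition.contDiff (n := 1)).differentiable one_ne_zero _).hasDerivAt
  have h1 : HasFDerivAt re reCLM w := reCLM.hasFDerivAt
  have h2 : HasFDerivAt im imCLM w := imCLM.hasFDerivAt
  have h3 : HasFDerivAt (fun w : ℂ => 2 - normSq w) _ w :=
    ((h1.mul h1).add (h2.mul h2)).const_sub 2
  have h4 : HasFDerivAt (Real.smoothTransition ∘ fun w : ℂ => 2 - normSq w) _ w :=
    hT.comp_hasFDerivAt w h3
  have h5 : HasFDerivAt radialBump _ w := ofRealCLM.hasFDerivAt.comp w h4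
  rw [dbar, h5.fderiv]
  apply Complex.ext <;> simp <;> ring

/-- The constant `∫ ∂̄η(w) / w` of the Cauchy–Pompeiu formula, for the fixed bump `η`. -/
noncomputable def pompeiuConst : ℂ := ∫ w, dbar radialBump w / w

/-- For the radial bump `η = ρ(|w|²)` the integrand `∂̄η(w) / w` is `2 ρ'(|w|²)`, which is real, of
constant sign and not identically zero. -/
theorem pompeiuConst_ne_zero : pompeiuConst ≠ 0 := by
  have hTc : Continuous (deriv Real.smoothTransition) :=
    (Real.smoothTransition.contDiff (n := 1)).continuous_deriv le_rfl
  have h1 : deriv Real.smoothTransition 2 = 0 := by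
    have : Real.smoothTransition =ᶠ[𝓝 2] fun _ => 1 := by
      filter_upwards [Ioi_mem_nhds (show (1 : ℝ) < 2 by norm_num)] with t ht
      exact Real.smoothTransition.one_of_one_le (le_of_lt ht)
    rw [this.deriv_eq, deriv_const]
  obtain ⟨t, ht⟩ : ∃ t, deriv Real.smoothTransition t ≠ 0 := by
    by_contra! h
    have := is_const_of_deriv_eq_zero
      ((Real.smoothTransition.contDiff (n := 1)).differentiable one_ne_zero) h 0 1
    simp at this
  have ht0 : t ≤ 2 := by
    by_contra! h
    refine ht ?_
    have : Real.smoothTransition =ᶠ[𝓝 t] fun _ => 1 := by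
      filter_upwards [Ioi_mem_nhds (show (1 : ℝ) < t by linarith)] with t ht
      exact Real.smoothTransition.one_of_one_le (le_of_lt ht)
    rw [this.deriv_eq, deriv_const]
  have hzero : ∀ s < 0, deriv Real.smoothTransition s = 0 := by
    intro s hs
    have : Real.smoothTransition =ᶠ[𝓝 s] fun _ => 0 := by
      filter_upwards [Iio_mem_nhds hs] with t ht
      exact Real.smoothTransition.zero_of_nonpos (le_of_lt ht)
    rw [this.deriv_eq, deriv_const]
  have hmono : Monotone Real.smoothTransition := Real.smoothTransition.monotone
  set F : ℂ → ℝ := fun w => 2 * deriv Real.smoothTransition (2 - normSq w)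
  have hFc : Continuous F := by
    have := continuous_normSq
    fun_prop
  have hpos : 0 < ∫ w, F w := by
    refine hFc.integral_pos_of_hasCompactSupport_nonneg_nonzero
      (x := ((Real.sqrt (2 - t) : ℝ) : ℂ))
      (HasCompactSupport.intro (isCompact_closedBall 0 2) fun w hw => ?_)
      (fun w => mul_nonneg zero_le_two hmono.deriv_nonneg) ?_
    · have hw' : 2 < ‖w‖ := by simpa using hw
      have : 2 - normSq w < 0 := by rw [normSq_eq_norm_sq]; nlinarith
      simp [F, hzero _ this]
    · simp only [F, normSq_ofReal, Real.mul_self_sqrt (sub_nonneg.2 ht0), sub_sub_cancel]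
      exact mul_ne_zero two_ne_zero ht
  have heq : pompeiuConst = -((∫ w, F w : ℝ) : ℂ) := by
    rw [pompeiuConst, ← integral_complex_ofReal, ← integral_neg]
    congr 1
    ext w
    rw [dbar_radialBump]
    rcases eq_or_ne w 0 with rfl | hw
    · simp [F, h1]
    · rw [mul_div_cancel_right₀ _ hw]
  rw [heq, neg_ne_zero, ofReal_ne_zero]
  exact hpos.ne'

/-- The **Cauchy–Pompeiu formula** for a `C^1` function with compact support, at a point near which
the function is holomorphic. Only `pompeiuConst_ne_zero` matters about the constant, so its value is
not computed. -/
theorem integral_dbar_div_sub {u : ℂ → ℂ} (hu : ContDiff ℝ 1 u) (hc : HasCompactSupport u) {z : ℂ}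
    (hz : ∀ᶠ w in 𝓝 z, DifferentiableAt ℂ u w) :
    ∫ w, dbar u w / (w - z) = u z * pompeiuConst := by
  set η : ℂ → ℂ := fun w => radialBump (w - z)
  have hη : ContDiff ℝ 1 η := contDiff_radialBump.comp (contDiff_id.sub contDiff_const)
  have hηc : HasCompactSupport η :=
    hasCompactSupport_radialBump.comp_homeomorph (Homeomorph.subRight z)
  have hηz : ∀ᶠ w in 𝓝 z, DifferentiableAt ℂ η w := by
    have : Tendsto (fun w => w - z) (𝓝 z) (𝓝 0) := by
      have : Continuous fun w => w - z := by fun_prop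
      simpa using this.tendsto z
    filter_upwards [(this.eventually eventually_radialBump_eq_one).eventually_nhds] with w hw
    exact (differentiableAt_const (1 : ℂ)).congr_of_eventuallyEq hw
  have hη1 : η z = 1 := by simp [η, eventually_radialBump_eq_one.eq_of_nhds]
  have hηint : ∫ w, dbar η w / (w - z) = pompeiuConst := by
    have : ∀ w, dbar η w = dbar radialBump (w - z) := fun w => by
      simp only [dbar, η, fderiv_comp_sub]
    simp only [this]
    exact integral_sub_right_eq_self (fun w => dbar radialBump w / w) z
  have hv := integral_dbar_div_sub_of_eq_zero (u := fun w => u w - u z * η w) (z := z)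
    (hu.sub (contDiff_const.mul hη)) (hc.sub hηc.mul_left)
    (by filter_upwards [hz, hηz] with w h1 h2 using h1.sub (h2.const_mul _)) (by simp [hη1])
  have hd : ∀ w, dbar (fun x => u x - u z * η x) w / (w - z)
      = dbar u w / (w - z) - u z * (dbar η w / (w - z)) := fun w => by
    rw [dbar_sub_const_mul _ (hu.differentiable one_ne_zero w) (hη.differentiable one_ne_zero w)]
    ring
  simp only [hd] at hv
  rw [integral_sub (integrable_dbar_div_sub hu hc hz)
    ((integrable_dbar_div_sub hη hηc hηz).const_mul _), integral_const_mul, hηint] at hv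
  exact sub_eq_zero.1 hv

end CauchyPompeiu

/-! ### Runge's theorem -/

section Runge

open Complex Topology Filter MeasureTheory

theorem Subalgebra.exists_mul_one_sub_eq_one {A : Type*} [NormedRing A] [NormedAlgebra ℂ A]
    [CompleteSpace A] {S : Subalgebra ℂ A} (hS : IsClosed (S : Set A)) {x : A} (hx : x ∈ S)
    (h : ‖x‖ < 1) : ∃ y ∈ S, y * (1 - x) = 1 := by
  refine ⟨∑' n : ℕ, x ^ n, ?_, geom_series_mul_neg x h⟩
  exact hS.mem_of_tendsto (summable_geometric_of_norm_lt_one h).hasSum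
    (Eventually.of_forall fun s => S.sum_mem fun n _ => S.pow_mem hx n)

/-- The closure `P(K)` of the polynomials in `C(K, ℂ)`. -/
noncomputable def polyClosure (K : Set ℂ) [CompactSpace K] : Subalgebra ℂ C(K, ℂ) :=
  (Algebra.adjoin ℂ {coordFun K}).topologicalClosure

theorem isClosed_polyClosure (K : Set ℂ) [CompactSpace K] :
    IsClosed (polyClosure K : Set C(K, ℂ)) :=
  Subalgebra.isClosed_topologicalClosure _

theorem coordFun_mem_polyClosure (K : Set ℂ) [CompactSpace K] : coordFun K ∈ polyClosure K :=
  Subalgebra.le_topologicalClosure _ (Algebra.self_mem_adjoin_singleton ℂ _)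

theorem polyClosure_le {K : Set ℂ} [CompactSpace K] {N : Submodule ℂ C(K, ℂ)}
    (hN : IsClosed (N : Set C(K, ℂ))) (h : ∀ n : ℕ, coordFun K ^ n ∈ N) {f : C(K, ℂ)}
    (hf : f ∈ polyClosure K) : f ∈ N := by
  refine closure_minimal (fun f hf => ?_) hN hf
  obtain ⟨p, rfl⟩ := (Algebra.adjoin_singleton_eq_range_aeval ℂ (coordFun K)).le hf
  simp only [AlgHom.toRingHom_eq_coe, RingHom.coe_coe, Polynomial.aeval_eq_sum_range]
  exact N.sum_mem fun n _ => N.smul_mem _ (h n)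

/-- The points `w` whose Cauchy kernel `z ↦ 1 / (w - z)` is a uniform limit of polynomials on `K`.
The complement of this set is the polynomially convex hull of `K`. -/
def polePoints (K : Set ℂ) [CompactSpace K] : Set ℂ :=
  {w | ∃ f ∈ polyClosure K, ∀ z : K, f z * (w - z) = 1}

section polePoints

variable {K : Set ℂ} [CompactSpace K]

theorem notMem_of_mem_polePoints {w : ℂ} (hw : w ∈ polePoints K) : w ∉ K := by
  obtain ⟨f, -, hf⟩ := hw
  intro h
  simpa using hf ⟨w, h⟩

/-- Pole pushing: the kernel at `v` is a geometric series in the kernel at `w` as long as `v` is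
closer to `w` than `K` is. -/
theorem mem_polePoints_of_norm_sub_lt {v w : ℂ} (hw : w ∈ polePoints K) {d : ℝ}
    (hd : ∀ z ∈ K, d ≤ ‖w - z‖) (hv : ‖w - v‖ < d) : v ∈ polePoints K := by
  obtain ⟨f, hf, hfw⟩ := hw
  have hd0 : 0 < d := (norm_nonneg _).trans_lt hv
  have hfn : ‖f‖ ≤ d⁻¹ := by
    refine (ContinuousMap.norm_le _ (by positivity)).2 fun z => ?_
    rw [eq_inv_of_mul_eq_one_left (hfw z), norm_inv]
    exact inv_anti₀ hd0 (hd z z.2)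
  have hn : ‖(w - v) • f‖ < 1 := by
    rw [norm_smul]
    calc ‖w - v‖ * ‖f‖ ≤ ‖w - v‖ * d⁻¹ := by gcongr
      _ < d * d⁻¹ := by gcongr
      _ = 1 := mul_inv_cancel₀ hd0.ne'
  obtain ⟨g, hg, hgf⟩ := Subalgebra.exists_mul_one_sub_eq_one (isClosed_polyClosure K)
    (Subalgebra.smul_mem _ hf (w - v)) hn
  refine ⟨g * f, mul_mem hg hf, fun z => ?_⟩
  have h1 := congrArg (fun F : C(K, ℂ) => F z) hgf
  simp only [ContinuousMap.mul_apply, ContinuousMap.sub_apply, ContinuousMap.one_apply,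
    ContinuousMap.smul_apply, smul_eq_mul] at h1 ⊢
  linear_combination h1 + g z * hfw z

theorem mem_polePoints_of_norm_lt {w : ℂ} (hw : ‖coordFun K‖ < ‖w‖) : w ∈ polePoints K := by
  have hw0 : 0 < ‖w‖ := (norm_nonneg _).trans_lt hw
  have hn : ‖w⁻¹ • coordFun K‖ < 1 := by
    rw [norm_smul, norm_inv, inv_mul_lt_one₀ hw0]
    exact hw
  obtain ⟨g, hg, hgf⟩ := Subalgebra.exists_mul_one_sub_eq_one (isClosed_polyClosure K)
    (Subalgebra.smul_mem _ (coordFun_mem_polyClosure K) w⁻¹) hn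
  refine ⟨w⁻¹ • g, Subalgebra.smul_mem _ hg _, fun z => ?_⟩
  have h1 := congrArg (fun F : C(K, ℂ) => F z) hgf
  simp only [ContinuousMap.mul_apply, ContinuousMap.sub_apply, ContinuousMap.one_apply,
    ContinuousMap.smul_apply, smul_eq_mul, coordFun_apply] at h1 ⊢
  have := norm_pos_iff.1 hw0
  rw [← h1]
  field_simp

theorem exists_pos_forall_le_norm_sub {w : ℂ} (hw : w ∉ K) : ∃ d > 0, ∀ z ∈ K, d ≤ ‖w - z‖ := by
  have hK : IsClosed K := (isCompact_iff_compactSpace.2 ‹_›).isClosed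
  obtain ⟨d, hd, h⟩ := Metric.isOpen_iff.1 hK.isOpen_compl w hw
  refine ⟨d, hd, fun z hz => ?_⟩
  by_contra! hlt
  exact h (by rwa [mem_ball_iff_norm']) hz

theorem isOpen_polePoints : IsOpen (polePoints K) := by
  refine Metric.isOpen_iff.2 fun w hw => ?_
  obtain ⟨d, hd, h⟩ := exists_pos_forall_le_norm_sub (notMem_of_mem_polePoints hw)
  exact ⟨d, hd, fun v hv => mem_polePoints_of_norm_sub_lt hw h (mem_ball_iff_norm'.1 hv)⟩

/-- Pole pushing, read backwards: off `K`, the set `polePoints K` is relatively closed. -/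
theorem isOpen_compl_polePoints_diff : IsOpen ((polePoints K)ᶜ \ K) := by
  refine Metric.isOpen_iff.2 fun w hw => ?_
  obtain ⟨d, hd, h⟩ := exists_pos_forall_le_norm_sub hw.2
  have hfar : ∀ v ∈ Metric.ball w (d / 2), ∀ z ∈ K, d / 2 ≤ ‖v - z‖ := fun v hv z hz => by
    have h1 := norm_sub_le_norm_sub_add_norm_sub w v z
    have h2 := h z hz
    have h3 := mem_ball_iff_norm'.1 hv
    linarith
  refine ⟨d / 2, by positivity, fun v hv => ⟨fun hvP => hw.1 ?_, fun hvK => ?_⟩⟩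
  · exact mem_polePoints_of_norm_sub_lt hvP (hfar v hv) (mem_ball_iff_norm.1 hv)
  · have := hfar v hv v hvK
    rw [sub_self, norm_zero] at this
    linarith

theorem isCompact_compl_polePoints : IsCompact (polePoints K)ᶜ := by
  refine (isCompact_closedBall (0 : ℂ) ‖coordFun K‖).of_isClosed_subset
    isOpen_polePoints.isClosed_compl fun w hw => ?_
  rw [mem_closedBall_zero_iff]
  by_contra! h
  exact hw (mem_polePoints_of_norm_lt h)

/-- A simply connected open set contains the polynomially convex hull of each of its compact
subsets. -/
theorem IsSimplyConnected.compl_polePoints_subset {D : Set ℂ} (hDo : IsOpen D)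
    (hDs : IsSimplyConnected D) (hKD : K ⊆ D) : (polePoints K)ᶜ ⊆ D := by
  have hfr : frontier ((polePoints K)ᶜ \ K) ⊆ K := by
    intro x hx
    rw [isOpen_compl_polePoints_diff.frontier_eq] at hx
    by_contra hxK
    refine hx.2 ⟨?_, hxK⟩
    exact isOpen_polePoints.isClosed_compl.closure_subset
      (closure_mono Set.sdiff_subset hx.1)
  have hsub := hDs.subset_of_frontier_subset hDo
    (isCompact_compl_polePoints.isBounded.subset Set.sdiff_subset) (hfr.trans hKD)
  intro x hx
  by_cases hxK : x ∈ K
  · exact hKD hxK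
  · exact hsub ⟨hx, hxK⟩

end polePoints

/-- A function holomorphic near a compact set agrees near that set with a `C^1` function of compact
support on the plane. -/
theorem exists_contDiff_hasCompactSupport_eq_nhdsSet {D K : Set ℂ} (hDo : IsOpen D)
    (hK : IsCompact K) (hKD : K ⊆ D) {g : ℂ → ℂ} (hg : DifferentiableOn ℂ g D) :
    ∃ u : ℂ → ℂ, ContDiff ℝ 1 u ∧ HasCompactSupport u ∧ ∀ z ∈ K, u =ᶠ[𝓝 z] g := by
  obtain ⟨L, hL, hKL, hLD⟩ := exists_compact_between hK hDo hKD
  obtain ⟨χ, hχ0, hχ1, -⟩ := exists_contMDiffMap_zero_one_nhds_of_isClosed (n := 1)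
    (modelWithCornersSelf ℝ ℂ) (isOpen_interior (s := L)).isClosed_compl hK.isClosed
    (Set.disjoint_left.2 fun x hx hxK => hx (hKL hxK))
  rw [eventually_nhdsSet_iff_forall] at hχ0 hχ1
  have hχ : ContDiff ℝ 1 χ := χ.contMDiff.contDiff
  refine ⟨fun w => χ w * g w, contDiff_iff_contDiffAt.2 fun w => ?_, ?_, fun z hz => ?_⟩
  · by_cases hw : w ∈ interior L
    · have hgw : ContDiffAt ℂ 1 g w :=
        (hg.analyticAt (hDo.mem_nhds (hLD (interior_subset hw)))).contDiffAt
      exact (ofRealCLM.contDiff.contDiffAt.comp w hχ.contDiffAt).mul (hgw.restrict_scalars ℝ)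
    · refine (contDiffAt_const (c := (0 : ℂ))).congr_of_eventuallyEq ?_
      filter_upwards [hχ0 w hw] with x hx
      simp [hx]
  · refine HasCompactSupport.intro hL fun w hw => ?_
    simp [(hχ0 w fun h => hw (interior_subset h)).self_of_nhds]
  · filter_upwards [hχ1 z hz] with x hx
    simp [hx]

/-- **Runge's theorem** for simply connected domains. The Cauchy–Pompeiu formula for a cutoff `u` of
`g` writes `g` on `K` as a Bochner integral in `C(K, ℂ)` of multiples of Cauchy kernels whose poles
lie in the support of `dbar u`, hence outside the hull `(polePoints K)ᶜ`. -/
theorem mem_polyClosure_of_differentiableOn {D K : Set ℂ} [CompactSpace K] (hDo : IsOpen D)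
    (hDs : IsSimplyConnected D) (hKD : K ⊆ D) {g : ℂ → ℂ} (hg : DifferentiableOn ℂ g D)
    {G : C(K, ℂ)} (hG : ∀ z : K, G z = g z) : G ∈ polyClosure K := by
  have hhull := hDs.compl_polePoints_subset hDo hKD
  obtain ⟨u, hu, huc, hug⟩ := exists_contDiff_hasCompactSupport_eq_nhdsSet hDo
    isCompact_compl_polePoints hhull hg
  have hKhull : ∀ z ∈ K, z ∈ (polePoints K)ᶜ := fun z hz h => notMem_of_mem_polePoints h hz
  -- So `dbar u` vanishes near the hull, and the kernel `1 / (w - z)` is harmless for `z ∈ K`.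
  have hhol : ∀ z ∈ (polePoints K)ᶜ, ∀ᶠ w in 𝓝 z, DifferentiableAt ℂ u w := by
    intro z hz
    filter_upwards [(hug z hz).eventually_nhds, hDo.mem_nhds (hhull hz)] with w h1 h2
    exact (hg.differentiableAt (hDo.mem_nhds h2)).congr_of_eventuallyEq h1
  have hcont : Continuous fun p : ℂ × K => dbar u p.1 / (p.1 - p.2) := by
    refine continuous_iff_continuousAt.2 fun p => ?_
    by_cases hp : p.1 ∈ polePoints K
    · refine (hu.continuous_dbar.comp continuous_fst).continuousAt.div (by fun_prop) ?_
      rw [sub_ne_zero]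
      intro h
      exact notMem_of_mem_polePoints hp (h ▸ p.2.2)
    · refine (continuousAt_const (y := (0 : ℂ))).congr ?_
      filter_upwards [continuousAt_fst.eventually (hhol p.1 hp)] with q hq
      simp [dbar_eq_zero hq]
  set Φ : C(ℂ, C(K, ℂ)) := ContinuousMap.curry ⟨_, hcont⟩
  have hΦ : ∀ w z, Φ w z = dbar u w / (w - z) := fun _ _ => rfl
  have hΦi : Integrable Φ := by
    refine Φ.continuous.integrable_of_hasCompactSupport (HasCompactSupport.intro huc fun w hw => ?_)
    ext z
    rw [hΦ, Function.support_subset_iff'.1 (support_dbar_subset u) w hw, zero_div]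
    rfl
  have hΦP : ∀ w, Φ w ∈ polyClosure K := by
    intro w
    by_cases hw : w ∈ polePoints K
    · obtain ⟨f, hf, hfw⟩ := hw
      have : Φ w = dbar u w • f := by
        ext z
        rw [hΦ, ContinuousMap.smul_apply, eq_inv_of_mul_eq_one_left (hfw z), smul_eq_mul,
          div_eq_mul_inv]
      rw [this]
      exact Subalgebra.smul_mem _ hf _
    · have : Φ w = 0 := by
        ext z
        rw [hΦ, dbar_eq_zero (hhol w hw).self_of_nhds, zero_div]
        rfl
      rw [this]
      exact zero_mem _
  have hI : ∫ w, Φ w ∈ polyClosure K := by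
    refine Submodule.mem_of_forall_dual_eq_zero (N := (polyClosure K).toSubmodule)
      (isClosed_polyClosure K) fun ℓ hℓ => ?_
    rw [← ℓ.integral_comp_comm hΦi]
    simp [fun w => hℓ _ (hΦP w)]
  have hGI : G = pompeiuConst⁻¹ • ∫ w, Φ w := by
    ext z
    have h1 : (∫ w, Φ w) z = ∫ w, Φ w z :=
      ((ContinuousMap.evalCLM ℂ z : C(K, ℂ) →L[ℂ] ℂ).integral_comp_comm hΦi).symm
    have h2 := integral_dbar_div_sub hu huc (hhol z (hKhull z z.2))
    rw [ContinuousMap.smul_apply, h1, smul_eq_mul]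
    simp only [hΦ]
    rw [h2, (hug z (hKhull z z.2)).eq_of_nhds, hG]
    field_simp [pompeiuConst_ne_zero]
  rw [hGI]
  exact Subalgebra.smul_mem _ hI _

end Runge

/-! ### Density of shallow networks -/

theorem theorem1 (φ : ℂ → ℂ) (hφ : Differentiable ℂ φ)
    (hpoly : ¬ ∃ p : Polynomial ℂ, ∀ z : ℂ, φ z = p.eval z)
    (D : Set ℂ) (hDo : IsOpen D) (hDs : IsSimplyConnected D) :
    ∀ g : ℂ → ℂ, DifferentiableOn ℂ g D →
      ∀ K : Set ℂ, IsCompact K → K ⊆ D →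
        ∀ ε : ℝ, 0 < ε →
          ∃ N : ℕ, 1 ≤ N ∧ ∃ a b c : Fin N → ℂ,
            (⨆ z : K, ‖g z - shallowNetwork φ a b c z‖) < ε := by
  intro g hg K hK hKD ε hε
  have : CompactSpace K := isCompact_iff_compactSpace.1 hK
  set S : Set C(K, ℂ) := Set.range fun p : ℂ × ℂ => hiddenUnit φ hφ.continuous K p.1 p.2
  set V := (Submodule.span ℂ S).topologicalClosure
  have hVc : IsClosed (V : Set C(K, ℂ)) := Submodule.isClosed_topologicalClosure _
  have hu : ∀ b c, hiddenUnit φ hφ.continuous K b c ∈ V := fun b c =>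
    Submodule.le_topologicalClosure _ (Submodule.subset_span ⟨(b, c), rfl⟩)
  set G : C(K, ℂ) := ⟨K.domRestrict g, (hg.continuousOn.mono hKD).domRestrict⟩
  have hGV : G ∈ V :=
    polyClosure_le hVc (coordFun_pow_mem_of_hiddenUnit_mem hφ hpoly K hVc hu)
      (mem_polyClosure_of_differentiableOn hDo hDs hKD hg fun _ => rfl)
  obtain ⟨s, hs, hGs⟩ := Metric.mem_closure_iff.1 hGV (ε / 2) (by positivity)
  obtain ⟨n, a, v, rfl⟩ := Submodule.mem_span_set'.1 hs
  choose p hp using fun i => (v i).2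
  -- A hidden unit of weight `0` is added, as `n` may be `0`.
  refine ⟨n + 1, by simp, Fin.cons 0 a, Fin.cons 0 fun i => (p i).1, Fin.cons 0 fun i => (p i).2,
    lt_of_le_of_lt (Real.iSup_le (fun z => ?_) (by positivity)) (half_lt_self hε)⟩
  have hz : (∑ i, a i • (v i : C(K, ℂ))) z = ∑ i, a i * φ ((p i).1 * z + (p i).2) := by
    rw [ContinuousMap.sum_apply]
    refine Finset.sum_congr rfl fun i _ => ?_
    rw [ContinuousMap.smul_apply, ← hp i]
    rfl
  have h := (ContinuousMap.dist_apply_le_dist (f := G) (g := ∑ i, a i • (v i : C(K, ℂ))) z).trans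
    hGs.le
  rw [dist_eq_norm, hz] at h
  have hGz : G z = g z := rfl
  rw [hGz] at h
  simpa [shallowNetwork, Fin.sum_univ_succ] using h
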